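/- **Setting.** Let $\mathcal H=\mathcal H_{\bar 0}\oplus\mathcal H_{\bar 1}$ be a $\mathbb Z_2$-graded complex Hilbert space with $\mathcal H_{\bar k}=\mathcal E_{\bar k}\oplus\mathcal E_{\bar k}^*$ (orthogonal sums of closed subspaces), where $f\mapsto f^*$ is an antiunitary involution of $\mathcal H$ which interchanges $\mathcal E_{\bar k}$ and $\mathcal E_{\bar k}^*$. Let $\Lambda$ be the Hilbert–Grassmann algebra over $\mathbb C$ with generators $\kappa_1,\kappa_2,\dots$, i.e. the completion of the Grassmann algebra for the norm $\|\sum_A c_A\kappa_A\|_\Lambda^2=\sum_A(|A|!)^{-2}|c_A|^2$, where $A=\{a_1<\dots<a_p\}$ runs over the finite subsets of $\mathbb N$ and $\kappa_A=\kappa_{a_1}\cdots\kappa_{a_p}$; let $\Lambda_{\bar 0},\Lambda_{\bar 1}$ be its even and odd parts. Let $c$ be any constant with $\|\lambda\mu\|_\Lambda\le c\|\lambda\|_\Lambda\|\mu\|_\Lambda$ for all $\lambda,\mu\in\Lambda$; $c=\sqrt3$ is admissible. Let $\mathcal S_p(\mathcal H)=\mathbf P^{(p)}\mathcal H^{\widehat\otimes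 p}$ be the graded symmetric tensors of degree $p$, where $\mathbf P^{(p)}$ is the projection with $\mathbf P^{(p)}(f_1\otimes\dots\otimes f_p)=\frac1{p!}\sum_\sigma\chi_\sigma f_{\sigma(1)}\otimes\dots\otimes f_{\sigma(p)}$ for $f_a\in\mathcal H_{\bar0}\cup\mathcal H_{\bar1}$, and $\chi_\sigma=\pm1$ is the parity of the number of inversions of $\sigma$ between odd arguments. The product is $F\odot G=\sqrt{\tfrac{(p+q)!}{p!\,q!}}\,\mathbf P^{(p+q)}(F\otimes G)$ for $F\in\mathcal S_p(\mathcal H)$, $G\in\mathcal S_q(\mathcal H)$, and it is extended to $\Lambda$-valued tensors by $(\lambda\otimes F)(\mu\otimes G)=\lambda\mu\otimes(F\odot G)$. For $\gamma\in\mathbb R$ let $\mathcal S^\Lambda_{(\gamma)}(\mathcal H)$ be the space of all $\Xi=\sum_p\Xi_p$, $\Xi_p\in\Lambda\widehat\otimes\mathcal S_p(\mathcal H)$ (Hilbert tensor product), with $\|\Xi\|_{(\gamma)}^2=\sum_p(p!)^\gamma\|\Xi_p\|^2<\infty$, and $\|\Xi\|=\|\Xi\|_{(0)}$. Let $\mathcal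 H_\Lambda=(\Lambda_{\bar0}\widehat\otimes\mathcal H_{\bar0})\oplus(\Lambda_{\bar1}\widehat\otimes\mathcal H_{\bar1})\subset\Lambda\widehat\otimes\mathcal H$ be the superspace, and for $\zeta\in\mathcal H_\Lambda$ let $\exp\zeta=\sum_p\frac1{p!}\zeta^p$. Let $\langle\lambda\otimes F\mid\mu\otimes G\rangle=\lambda\mu\,(F^*\mid G)$ be the continuous $\Lambda$-bilinear pairing, where $(f_1\otimes\dots\otimes f_p)^*=f_p^*\otimes\dots\otimes f_1^*$ and tensors of different degrees pair to $0$. **Lemma.** Let $\gamma>-1$ and $\Xi\in\mathcal S^\Lambda_{(\gamma)}(\mathcal H)$. Then the series $$\varphi_\Xi(\zeta)=\langle\exp\zeta\mid\Xi\rangle=\sum_{p=0}^\infty\frac1{p!}\langle\zeta^p\mid\Xi_p\rangle$$ converges absolutely in $\Lambda$ for every $\zeta\in\mathcal H_\Lambda$, and $\varphi_\Xi:\mathcal H_\Lambda\to\Lambda$ is an entire analytic function: it is the sum of a power series (of continuous complex-multilinear maps) with infinite radius of convergence, and all its Fréchet derivatives are $\Lambda_{\bar0}$-linear in each argument. If $\gamma=0$,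 then for all $\zeta\in\mathcal H_\Lambda$ $$\|\varphi_\Xi(\zeta)\|_\Lambda\le\|\Xi\|\exp\left(\tfrac12c^2\|\zeta\|^2\right).$$ -/

import Mathlib

open scoped Nat ENNReal

noncomputable section

namespace FockSuper

/-! ### Square-summable families -/

section SquareSummable

variable {α : Type*} {E : α → Type*} [∀ i, NormedAddCommGroup (E i)]

theorem memlp_two {f : ∀ i, E i} (h : Summable fun i => ‖f i‖ ^ 2) : Memℓp f 2 := by
  apply memℓp_gen
  simpa using h

theorem summable_sq (f : lp E 2) : Summable fun i => ‖f i‖ ^ 2 := by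
  have := (lp.memℓp f).summable (by norm_num)
  simpa using this

theorem norm_sq_eq (f : lp E 2) : ‖f‖ ^ 2 = ∑' i, ‖f i‖ ^ 2 := by
  have := lp.norm_rpow_eq_tsum (p := 2) (by norm_num) f
  simpa using this

theorem norm_le_of_sq {f : lp E 2} {C : ℝ} (hC : 0 ≤ C) (h : ∑' i, ‖f i‖ ^ 2 ≤ C ^ 2) :
    ‖f‖ ≤ C := by
  rw [← norm_sq_eq] at h
  exact abs_le_of_sq_le_sq' h hC |>.2

end SquareSummable

/-! ### The Hilbert-Grassmann algebra -/

/-- The Hilbert-Grassmann algebra `Λ` with generators `κ 0, κ 1, …`. An element is written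
`∑ A, c A • κ A`, where `A = {a₁ < … < aₚ}` runs over the finite subsets of `ℕ` and
`κ A = κ a₁ ⋯ κ aₚ`, and its squared norm is `∑ A, (|A|!)⁻² |c A|²`. It is stored through its
coordinates `c A / |A|!` in the orthonormal basis `|A|! • κ A`. -/
abbrev Grassmann : Type := lp (fun _ : Finset ℕ => ℂ) 2

namespace Grassmann

/-- The coefficient of `κ A`. -/
def coeff (x : Grassmann) (A : Finset ℕ) : ℂ := (A.card ! : ℂ) * x A

/-- The sign with `κ A * κ B = sgn A B • κ (A ∪ B)` for disjoint `A`, `B`. -/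
def sgn (A B : Finset ℕ) : ℂ := (-1) ^ ((A ×ˢ B).filter fun q => q.2 < q.1).card

/-- The coefficient of `κ C` in the product `x * y`. -/
def mulCoeff (x y : Grassmann) (C : Finset ℕ) : ℂ :=
  ∑ A ∈ C.powerset, sgn A (C \ A) * coeff x A * coeff y (C \ A)

theorem norm_sgn (A B : Finset ℕ) : ‖sgn A B‖ = 1 := by simp [sgn]

theorem sum_inv_choose (n : ℕ) : ∑ k ∈ Finset.range (n + 1), ((n.choose k : ℝ))⁻¹ ≤ 3 := by
  rcases Nat.eq_zero_or_pos n with rfl | hn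
  · norm_num
  have hn' : (0 : ℝ) < n := by exact_mod_cast hn
  have h : ∀ k ∈ Finset.range (n + 1), ((n.choose k : ℝ))⁻¹ ≤
      (if k = 0 then 1 else 0) + (if k = n then 1 else 0) +
        (if k ∈ Finset.Ico 1 n then (n : ℝ)⁻¹ else 0) := by
    intro k hk
    rw [Finset.mem_range] at hk
    by_cases h0 : k = 0
    · subst h0
      have : ¬ (0 = n) := by omega
      simp [this]
    by_cases h1 : k = n
    · subst h1
      simp [h0]
    have hm : k ∈ Finset.Ico 1 n := by
      rw [Finset.mem_Ico]; omega
    have hle : n ≤ n.choose k := by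
      obtain ⟨m, rfl⟩ : ∃ m, n = m + 1 := ⟨n - 1, by omega⟩
      obtain ⟨j, rfl⟩ : ∃ j, k = j + 1 := ⟨k - 1, by omega⟩
      have aux : ∀ m j : ℕ, j + 1 ≤ m → m + 1 ≤ (m + 1).choose (j + 1) := by
        intro m
        induction m with
        | zero => intro j hj; omega
        | succ m ih =>
          intro j hj
          rw [Nat.choose_succ_succ, Nat.succ_eq_add_one]
          rcases Nat.lt_or_ge m (j + 1) with hlt | hge
          · have : j = m := by omega
            subst this
            simp
          · have h3 := ih j hge
            have h4 : 0 < (m + 1).choose j := Nat.choose_pos (by omega)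
            omega
      exact aux m j (by omega)
    have hle' : (n : ℝ) ≤ n.choose k := by exact_mod_cast hle
    simp only [h0, h1, hm, if_true, if_false]
    rw [zero_add, zero_add]
    exact inv_anti₀ hn' hle'
  refine (Finset.sum_le_sum h).trans ?_
  rw [Finset.sum_add_distrib, Finset.sum_add_distrib, Finset.sum_ite_eq', Finset.sum_ite_eq',
    ← Finset.sum_filter]
  have hc : ((Finset.range (n + 1)).filter fun k => k ∈ Finset.Ico 1 n).card ≤ n := by
    calc _ ≤ (Finset.Ico 1 n).card := Finset.card_le_card (by
            intro k hk; exact (Finset.mem_filter.1 hk).2)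
      _ ≤ n := by simp
  have hs : ∑ k ∈ (Finset.range (n + 1)).filter (fun k => k ∈ Finset.Ico 1 n), (n : ℝ)⁻¹ ≤ 1 := by
    rw [Finset.sum_const, nsmul_eq_mul, ← div_eq_mul_inv, div_le_one hn']
    exact_mod_cast hc
  have h5 : (if 0 ∈ Finset.range (n + 1) then (1 : ℝ) else 0) ≤ 1 := by split_ifs <;> norm_num
  have h6 : (if n ∈ Finset.range (n + 1) then (1 : ℝ) else 0) ≤ 1 := by split_ifs <;> norm_num
  linarith

theorem mulCoeff_bound (x y : Grassmann) (C : Finset ℕ) :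
    ‖(C.card ! : ℂ)⁻¹ * mulCoeff x y C‖ ^ 2 ≤
      3 * ∑ A ∈ C.powerset, ‖x A‖ ^ 2 * ‖y (C \ A)‖ ^ 2 := by
  have h1 : ‖(C.card ! : ℂ)⁻¹ * mulCoeff x y C‖ ≤
      ∑ A ∈ C.powerset, ((C.card.choose A.card : ℝ))⁻¹ * (‖x A‖ * ‖y (C \ A)‖) := by
    rw [mulCoeff, Finset.mul_sum]
    refine (norm_sum_le _ _).trans (Finset.sum_le_sum fun A hA => le_of_eq ?_)
    have hAC := Finset.mem_powerset.1 hA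
    have hcard := Finset.card_sdiff_of_subset hAC
    have hle := Finset.card_le_card hAC
    rw [coeff, coeff, norm_mul, norm_mul, norm_mul, norm_mul, norm_mul, norm_sgn, hcard,
      Nat.cast_choose ℝ hle, norm_inv]
    simp only [Complex.norm_natCast]
    rw [inv_div]
    ring
  have h2 : ∑ A ∈ C.powerset, (((C.card.choose A.card : ℝ))⁻¹) ^ 2 ≤ 3 := by
    rw [Finset.sum_powerset_apply_card (fun k => (((C.card.choose k : ℝ))⁻¹) ^ 2)]
    refine le_trans (le_of_eq (Finset.sum_congr rfl fun k hk => ?_)) (sum_inv_choose C.card)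
    have : (0 : ℝ) < C.card.choose k := by
      exact_mod_cast Nat.choose_pos (by rw [Finset.mem_range] at hk; omega)
    rw [nsmul_eq_mul]
    field_simp
  calc ‖(C.card ! : ℂ)⁻¹ * mulCoeff x y C‖ ^ 2
      ≤ (∑ A ∈ C.powerset, ((C.card.choose A.card : ℝ))⁻¹ * (‖x A‖ * ‖y (C \ A)‖)) ^ 2 := by
        gcongr
    _ ≤ (∑ A ∈ C.powerset, (((C.card.choose A.card : ℝ))⁻¹) ^ 2) *
        ∑ A ∈ C.powerset, (‖x A‖ * ‖y (C \ A)‖) ^ 2 := Finset.sum_mul_sq_le_sq_mul_sq _ _ _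
    _ ≤ 3 * ∑ A ∈ C.powerset, (‖x A‖ * ‖y (C \ A)‖) ^ 2 := by
        gcongr
    _ = _ := by simp only [mul_pow]

theorem sum_disjoint_le {g h : Finset ℕ → ℝ} (hg : Summable g) (hh : Summable h)
    (hg0 : ∀ A, 0 ≤ g A) (hh0 : ∀ A, 0 ≤ h A) (s : Finset (Finset ℕ)) :
    ∑ C ∈ s, ∑ A ∈ C.powerset, g A * h (C \ A) ≤ (∑' A, g A) * ∑' A, h A := by
  have hgh : Summable fun q : Finset ℕ × Finset ℕ => g q.1 * h q.2 :=
    hg.mul_of_nonneg hh hg0 hh0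
  rw [hg.tsum_mul_tsum hh hgh, Finset.sum_sigma']
  have himg : ∑ q ∈ s.sigma fun C => C.powerset, g q.2 * h (q.1 \ q.2) =
      ∑ q ∈ (s.sigma fun C => C.powerset).image (fun q => (q.2, q.1 \ q.2)), g q.1 * h q.2 := by
    rw [Finset.sum_image]
    rintro ⟨C, A⟩ h ⟨C', A'⟩ h' heq
    simp only [Finset.coe_sigma, Set.mem_sigma_iff, Finset.mem_coe, Finset.mem_powerset] at h h'
    simp only [Prod.mk.injEq] at heq
    obtain ⟨rfl, h2⟩ := heq
    have : C = C' := by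
      rw [← Finset.union_sdiff_of_subset h.2, h2, Finset.union_sdiff_of_subset h'.2]
    subst this
    rfl
  rw [himg]
  exact hgh.sum_le_tsum _ (fun q _ => mul_nonneg (hg0 q.1) (hh0 q.2))

theorem sum_mul_bound (x y : Grassmann) (s : Finset (Finset ℕ)) :
    ∑ C ∈ s, ‖(C.card ! : ℂ)⁻¹ * mulCoeff x y C‖ ^ 2 ≤ 3 * (‖x‖ ^ 2 * ‖y‖ ^ 2) := by
  have h1 := sum_disjoint_le (summable_sq x) (summable_sq y) (fun _ => sq_nonneg _)
    (fun _ => sq_nonneg _) s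
  rw [← norm_sq_eq, ← norm_sq_eq] at h1
  have h2 := Finset.sum_le_sum fun C (_ : C ∈ s) => mulCoeff_bound x y C
  rw [← Finset.mul_sum] at h2
  exact h2.trans (mul_le_mul_of_nonneg_left h1 (by norm_num))

theorem summable_mul (x y : Grassmann) :
    Summable fun C : Finset ℕ => ‖(C.card ! : ℂ)⁻¹ * mulCoeff x y C‖ ^ 2 :=
  summable_of_sum_le (fun _ => sq_nonneg _) (sum_mul_bound x y)

/-- The product of `Λ`. -/
instance : Mul Grassmann where
  mul x y := ⟨fun C => (C.card ! : ℂ)⁻¹ * mulCoeff x y C, memlp_two (summable_mul x y)⟩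

/-- The unit `κ ∅` of `Λ`. -/
instance : One Grassmann where
  one := lp.single 2 ∅ 1

theorem mul_apply (x y : Grassmann) (C : Finset ℕ) :
    (x * y) C = (C.card ! : ℂ)⁻¹ * mulCoeff x y C := rfl

theorem norm_mul_le' (x y : Grassmann) : ‖x * y‖ ≤ √3 * ‖x‖ * ‖y‖ := by
  apply norm_le_of_sq (by positivity)
  rw [mul_pow, mul_pow, Real.sq_sqrt (by norm_num), mul_assoc]
  exact (summable_mul x y).tsum_le_of_sum_le (sum_mul_bound x y)

theorem mul_add' (x y z : Grassmann) : x * (y + z) = x * y + x * z := by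
  apply lp.ext
  funext C
  rw [lp.coeFn_add, Pi.add_apply, mul_apply, mul_apply, mul_apply, ← mul_add]
  simp only [mulCoeff, coeff, ← Finset.sum_add_distrib, lp.coeFn_add, Pi.add_apply]
  congr 1
  exact Finset.sum_congr rfl fun A _ => by ring

theorem mul_smul' (x y : Grassmann) (c : ℂ) : x * (c • y) = c • (x * y) := by
  apply lp.ext
  funext C
  rw [lp.coeFn_smul, Pi.smul_apply, mul_apply, mul_apply]
  simp only [mulCoeff, coeff, lp.coeFn_smul, Pi.smul_apply, smul_eq_mul, Finset.mul_sum]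
  exact Finset.sum_congr rfl fun A _ => by ring

/-- The subspace `Λ_k` of elements of parity `k`: `k = 0` for even and `k = 1` for odd. -/
def parityPart (k : ZMod 2) : Submodule ℂ Grassmann where
  carrier := {x | ∀ A : Finset ℕ, x A ≠ 0 → (A.card : ZMod 2) = k}
  add_mem' := by
    intro x y hx hy A h
    by_cases h1 : x A = 0
    · exact hy A fun h2 => h (by rw [lp.coeFn_add, Pi.add_apply, h1, h2, add_zero])
    · exact hx A h1
  zero_mem' := by
    intro A h
    exact absurd rfl h
  smul_mem' := by
    intro c x hx A h
    exact hx A fun h1 => h (by rw [lp.coeFn_smul, Pi.smul_apply, h1, smul_zero])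

theorem mul_mem_parityPart {x y : Grassmann} {k : ZMod 2} (hx : x ∈ parityPart 0)
    (hy : y ∈ parityPart k) : x * y ∈ parityPart k := by
  intro C hC
  rw [mul_apply] at hC
  have h1 : mulCoeff x y C ≠ 0 := right_ne_zero_of_mul hC
  obtain ⟨A, hA, hne⟩ := Finset.exists_ne_zero_of_sum_ne_zero h1
  have h2 : coeff y (C \ A) ≠ 0 := right_ne_zero_of_mul hne
  have h3 : coeff x A ≠ 0 := right_ne_zero_of_mul (left_ne_zero_of_mul hne)
  have h4 := hx A (right_ne_zero_of_mul h3)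
  have h5 := hy (C \ A) (right_ne_zero_of_mul h2)
  have h6 := Finset.card_sdiff_add_card_eq_card (Finset.mem_powerset.1 hA)
  rw [← h6, Nat.cast_add, h4, h5, add_zero]

end Grassmann

/-! ### One-particle spaces -/

/-- The structure of a `ℤ/2`-graded one-particle space
`H = (E 0 ⊕ (E 0)*) ⊕ (E 1 ⊕ (E 1)*)`: the closed subspaces `E 0` and `E 1` of bosonic and
fermionic particles, and an antiunitary involution `f ↦ f*` which maps `E k` onto the space
`(E k)*` of antiparticles. These four subspaces are orthogonal and span `H`. -/
structure OneParticle (H : Type*) [NormedAddCommGroup H] [InnerProductSpace ℂ H] where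
  E : ZMod 2 → Submodule ℂ H
  conj : H ≃ₗᵢ⋆[ℂ] H
  conj_conj : ∀ f, conj (conj f) = f
  isClosed_E : ∀ k, IsClosed (E k : Set H)
  orthogonal_E : ∀ k l, k ≠ l → ∀ f ∈ E k, ∀ g ∈ E l, inner ℂ f g = 0
  orthogonal_conj : ∀ k l, ∀ f ∈ E k, ∀ g ∈ E l, inner ℂ f (conj g) = 0
  span_eq_top : ∀ f : H, ∃ u v : ZMod 2 → H, (∀ k, u k ∈ E k) ∧ (∀ k, v k ∈ E k) ∧
    f = ∑ k, (u k + conj (v k))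

/-- `f` has parity `k`, that is, `f ∈ E k ⊕ (E k)*`. -/
def OneParticle.HasParity {H : Type*} [NormedAddCommGroup H] [InnerProductSpace ℂ H]
    (S : OneParticle H) (k : ZMod 2) (f : H) : Prop :=
  ∃ u ∈ S.E k, ∃ v ∈ S.E k, f = u + S.conj v

/-- An orthonormal basis of `H` which consists of orthonormal bases of `E 0` and `E 1` (the
vectors with index `(i, false)`, where `par i` tells in which of the two spaces the vector is) and
of the conjugate vectors (index `(i, true)`). -/
structure ParticleBasis {H : Type*} [NormedAddCommGroup H] [InnerProductSpace ℂ H]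
    (S : OneParticle H) (ι : Type*) where
  basis : HilbertBasis (ι × Bool) ℂ H
  par : ι → ZMod 2
  mem_E : ∀ i, basis (i, false) ∈ S.E (par i)
  conj_basis : ∀ i, S.conj (basis (i, false)) = basis (i, true)

/-- Every one-particle space has such a basis. -/
theorem exists_particleBasis {H : Type*} [NormedAddCommGroup H] [InnerProductSpace ℂ H]
    [CompleteSpace H] (S : OneParticle H) :
    ∃ w : (k : ZMod 2) → Set (S.E k), Nonempty (ParticleBasis S (Σ k, w k)) := by
  classical
  have : ∀ k, CompleteSpace (S.E k) := fun k => (S.isClosed_E k).completeSpace_coe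
  choose w B hB using fun k => exists_hilbertBasis ℂ (S.E k)
  let v : (Σ k, w k) × Bool → H := fun j =>
    if j.2 then S.conj ((j.1.2 : S.E j.1.1) : H) else ((j.1.2 : S.E j.1.1) : H)
  have hconj : ∀ f g : H, inner ℂ (S.conj f) (S.conj g) = inner ℂ g f := by
    intro f g
    have hI : ∀ f g : H, S.conj f + Complex.I • S.conj g = S.conj (f - Complex.I • g) ∧
        S.conj f - Complex.I • S.conj g = S.conj (f + Complex.I • g) := by
      intro f g
      constructor
      · rw [map_sub, map_smulₛₗ, Complex.conj_I, neg_smul, sub_neg_eq_add]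
      · rw [map_add, map_smulₛₗ, Complex.conj_I, neg_smul, sub_eq_add_neg]
    rw [← inner_conj_symm g f, inner_eq_sum_norm_sq_div_four (𝕜 := ℂ) (S.conj f) (S.conj g),
      inner_eq_sum_norm_sq_div_four (𝕜 := ℂ) f g]
    have h4 : (starRingEnd ℂ) 4 = 4 := map_ofNat _ 4
    simp only [RCLike.I_to_complex, (hI f g).1, (hI f g).2, ← map_add, ← map_sub,
      LinearIsometryEquiv.norm_map, map_div₀, RCLike.ofReal_eq_complex_ofReal]
    simp [h4]
    ring
  have ho : ∀ k, Orthonormal ℂ (fun i : w k => (i : S.E k)) := fun k => by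
    have := (B k).orthonormal
    rwa [hB k] at this
  have hnorm : ∀ j, ‖v j‖ = 1 := by
    rintro ⟨⟨k, i⟩, t⟩
    have h1 : ‖((i : S.E k) : H)‖ = 1 := (ho k).1 i
    cases t
    · simpa [v] using h1
    · simpa [v] using h1
  have hin : ∀ i j : (Σ k, w k), i ≠ j →
      inner ℂ ((i.2 : S.E i.1) : H) ((j.2 : S.E j.1) : H) = 0 := by
    rintro ⟨k, i⟩ ⟨l, j⟩ hne
    by_cases hkl : k = l
    · subst hkl
      have hij : i ≠ j := fun h => hne (by rw [h])
      exact (ho k).2 hij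
    · exact S.orthogonal_E k l hkl _ (i : S.E k).2 _ (j : S.E l).2
  have hv : Orthonormal ℂ v := by
    refine ⟨hnorm, ?_⟩
    rintro ⟨i, s⟩ ⟨j, t⟩ hne
    cases s <;> cases t
    · have : i ≠ j := fun h => hne (by rw [h])
      simpa [v] using hin i j this
    · simpa [v] using S.orthogonal_conj i.1 j.1 _ (i.2 : S.E i.1).2 _ (j.2 : S.E j.1).2
    · have h := S.orthogonal_conj j.1 i.1 _ (j.2 : S.E j.1).2 _ (i.2 : S.E i.1).2
      rw [← inner_conj_symm, map_eq_zero] 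
      simpa [v] using h
    · have : j ≠ i := fun h => hne (by rw [h])
      simpa [v, hconj] using hin j i this
  let V : Submodule ℂ H := (Submodule.span ℂ (Set.range v)).topologicalClosure
  have hVc : IsClosed (V : Set H) := Submodule.isClosed_topologicalClosure _
  have hvV : ∀ j, v j ∈ V := fun j =>
    Submodule.le_topologicalClosure _ (Submodule.subset_span ⟨j, rfl⟩)
  have hu : ∀ k (f : H), f ∈ S.E k → f ∈ V ∧ S.conj f ∈ V := by
    intro k f hf
    have hspan : ∀ W : Submodule ℂ (S.E k), IsClosed (W : Set (S.E k)) →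
        (∀ i : w k, (i : S.E k) ∈ W) → (⟨f, hf⟩ : S.E k) ∈ W := by
      intro W hW h
      have h1 : (Submodule.span ℂ (Set.range (B k))).topologicalClosure ≤ W := by
        refine Submodule.topologicalClosure_minimal _ (Submodule.span_le.2 ?_) hW
        rintro _ ⟨i, rfl⟩
        rw [hB k]
        exact h i
      exact h1 (by rw [(B k).dense_span]; trivial)
    constructor
    · exact hspan (V.comap (S.E k).subtype) (hVc.preimage continuous_subtype_val)
        fun i => hvV (⟨k, i⟩, false)
    · exact hspan (V.comap (S.conj.toLinearEquiv.toLinearMap.comp (S.E k).subtype))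
        (hVc.preimage (S.conj.continuous.comp continuous_subtype_val))
        fun i => hvV (⟨k, i⟩, true)
  have htop : ⊤ ≤ V := by
    intro f _
    obtain ⟨u, v', h1, h2, rfl⟩ := S.span_eq_top f
    exact V.sum_mem fun k _ => V.add_mem (hu k _ (h1 k)).1 (hu k _ (h2 k)).2
  refine ⟨w, ⟨⟨HilbertBasis.mk hv htop, fun i => i.1, fun i => ?_, fun i => ?_⟩⟩⟩
  · rw [HilbertBasis.coe_mk]
    simp [v]
  · rw [HilbertBasis.coe_mk]
    simp [v]

/-! ### Tensors with coefficients in the Grassmann algebra -/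

/-- The completed tensor product `Λ ⊗ H^{⊗ n}`. Its elements are
`∑ a, X a ⊗ e (a 0) ⊗ … ⊗ e (a (n - 1))` with an orthonormal basis `(e j)` of `H`, coefficients
`X a ∈ Λ`, and squared norm `∑ a, ‖X a‖² < ∞`. -/
abbrev Tensor (J : Type*) (n : ℕ) : Type _ := lp (fun _ : Fin n → J => Grassmann) 2

section Tensor

variable {J : Type*}

/-- Left multiplication by an element of `Λ`, `x · (y ⊗ F) = (x y) ⊗ F`. -/
def lmul {n : ℕ} (x : Grassmann) : Tensor J n →L[ℂ] Tensor J n :=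
  have hb : ∀ (X : Tensor J n) (a : Fin n → J), ‖x * X a‖ ^ 2 ≤ (√3 * ‖x‖) ^ 2 * ‖X a‖ ^ 2 :=
    fun X a => by
      rw [← mul_pow]
      exact pow_le_pow_left₀ (norm_nonneg _) (Grassmann.norm_mul_le' x (X a)) 2
  have hs : ∀ X : Tensor J n, Summable fun a => ‖x * X a‖ ^ 2 := fun X =>
    Summable.of_nonneg_of_le (fun _ => sq_nonneg _) (hb X) ((summable_sq X).mul_left _)
  LinearMap.mkContinuous
    { toFun := fun X => ⟨fun a => x * X a, memlp_two (hs X)⟩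
      map_add' := fun X Y => lp.ext (funext fun a => Grassmann.mul_add' x (X a) (Y a))
      map_smul' := fun c X => lp.ext (funext fun a => Grassmann.mul_smul' x (X a) c) }
    (√3 * ‖x‖)
    (fun X => norm_le_of_sq (by positivity) (by
      rw [mul_pow, norm_sq_eq X, ← tsum_mul_left]
      exact (hs X).tsum_le_tsum (hb X) ((summable_sq X).mul_left _)))

theorem lmul_apply {n : ℕ} (x : Grassmann) (X : Tensor J n) (a : Fin n → J) :
    lmul x X a = x * X a := rfl

theorem summable_tensorMul {p q : ℕ} (X : Tensor J p) (Y : Tensor J q) :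
    Summable fun a : Fin (p + q) → J =>
      ‖X (fun i => a (Fin.castAdd q i)) * Y (fun i => a (Fin.natAdd p i))‖ ^ 2 := by
  have h : Summable fun r : (Fin p → J) × (Fin q → J) => ‖X r.1 * Y r.2‖ ^ 2 := by
    refine Summable.of_nonneg_of_le (fun _ => sq_nonneg _) (fun r => ?_)
      (((summable_sq X).mul_of_nonneg (summable_sq Y) (fun _ => sq_nonneg _)
        (fun _ => sq_nonneg _)).mul_left ((√3) ^ 2))
    rw [← mul_pow, ← mul_pow, ← mul_assoc]
    exact pow_le_pow_left₀ (norm_nonneg _) (Grassmann.norm_mul_le' _ _) 2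
  exact (Fin.appendEquiv p q).symm.summable_iff.2 h

/-- The `Λ`-extension `(x ⊗ F) ⊗ (y ⊗ G) = (x y) ⊗ (F ⊗ G)` of the tensor product. -/
def tensorMul {p q : ℕ} (X : Tensor J p) (Y : Tensor J q) : Tensor J (p + q) :=
  ⟨fun a => X (fun i => a (Fin.castAdd q i)) * Y (fun i => a (Fin.natAdd p i)),
    memlp_two (summable_tensorMul X Y)⟩

/-- The number of pairs `i < j` with `σ j < σ i` for which `a i` and `a j` are both fermionic. -/
def inversions (par : J → ZMod 2) {n : ℕ} (σ : Equiv.Perm (Fin n)) (a : Fin n → J) : ℕ :=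
  (Finset.univ.filter fun q : Fin n × Fin n =>
    q.1 < q.2 ∧ σ q.2 < σ q.1 ∧ par (a q.1) = 1 ∧ par (a q.2) = 1).card

/-- The graded action of a permutation on tensors,
`f 0 ⊗ … ⊗ f (n - 1) ↦ χ f (σ 0) ⊗ … ⊗ f (σ (n - 1))`, where the sign `χ` counts the inversions of
fermionic factors. It maps `e (a 0) ⊗ … ⊗ e (a (n - 1))` to a multiple of
`e (a (σ 0)) ⊗ … ⊗ e (a (σ (n - 1)))`, so that the new coefficient at `a` is, up to the sign, the
old one at `a ∘ σ⁻¹`. -/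
def gradedPerm (par : J → ZMod 2) {n : ℕ} (σ : Equiv.Perm (Fin n)) (X : Tensor J n) : Tensor J n :=
  ⟨fun a => (-1 : ℂ) ^ inversions par σ a • X (a ∘ σ.symm), memlp_two (by
    have h : Summable fun a : Fin n → J => ‖X (a ∘ σ.symm)‖ ^ 2 :=
      (Equiv.arrowCongr σ (Equiv.refl J)).summable_iff.2 (summable_sq X)
    simpa [norm_smul] using h)⟩

/-- The projection `P⁽ⁿ⁾` of `Λ ⊗ H^{⊗ n}` onto the graded symmetric tensors. -/
def gradedProj (par : J → ZMod 2) {n : ℕ} (X : Tensor J n) : Tensor J n :=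
  (n ! : ℂ)⁻¹ • ∑ σ : Equiv.Perm (Fin n), gradedPerm par σ X

/-- The graded product `X · Y = √((p + q)! / (p! q!)) P⁽ᵖ⁺ᵠ⁾ (X ⊗ Y)`. -/
def gradedMul (par : J → ZMod 2) {p q : ℕ} (X : Tensor J p) (Y : Tensor J q) : Tensor J (p + q) :=
  ((√(((p + q)! : ℝ) / ((p ! : ℝ) * (q ! : ℝ))) : ℝ) : ℂ) • gradedProj par (tensorMul X Y)

/-- The powers `ζ ^ p` of `ζ ∈ Λ ⊗ H` with respect to the graded product. -/
def gradedPow (par : J → ZMod 2) (ζ : Tensor J 1) : (p : ℕ) → Tensor J p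
  | 0 => lp.single 2 Fin.elim0 1
  | p + 1 => gradedMul par (gradedPow par ζ p) ζ

/-- The component `ζ ^ p / p!` of degree `p` of the coherent state `exp ζ`. -/
def coherent (par : J → ZMod 2) (ζ : Tensor J 1) (p : ℕ) : Tensor J p :=
  (p ! : ℂ)⁻¹ • gradedPow par ζ p

/-- The space `S^Λ_(γ)(H)`: sequences `Ξ = (Ξ p)` of graded symmetric tensors
`Ξ p ∈ Λ ⊗ S_p(H)` with `∑ p, (p!)^γ ‖Ξ p‖² < ∞`. -/
def IsFock (par : J → ZMod 2) (γ : ℝ) (Ξ : (p : ℕ) → Tensor J p) : Prop :=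
  (∀ p, gradedProj par (Ξ p) = Ξ p) ∧ Summable fun p => (p ! : ℝ) ^ γ * ‖Ξ p‖ ^ 2

/-- The norm `‖Ξ‖_(γ)` of `S^Λ_(γ)(H)`. -/
def fockNorm (γ : ℝ) (Ξ : (p : ℕ) → Tensor J p) : ℝ := √(∑' p, (p ! : ℝ) ^ γ * ‖Ξ p‖ ^ 2)

end Tensor

/-! ### Superspace, pairing, and the function of a tensor -/

section Basis

variable {H : Type*} [NormedAddCommGroup H] [InnerProductSpace ℂ H] {S : OneParticle H}
  {ι : Type*} (b : ParticleBasis S ι)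

/-- The parity of the basis vectors of `H`. -/
def ParticleBasis.parity (j : ι × Bool) : ZMod 2 := b.par j.1

/-- The index of the conjugate of a basis vector. -/
def bar (j : ι × Bool) : ι × Bool := (j.1, !j.2)

/-- The tensor `x ⊗ f ∈ Λ ⊗ H` of `x ∈ Λ` and `f ∈ H`. -/
def ParticleBasis.tmul (x : Grassmann) (f : H) : Tensor (ι × Bool) 1 :=
  ⟨fun a => inner ℂ (b.basis (a 0)) f • x, memlp_two (by
    have h : Summable fun a : Fin 1 → ι × Bool => ‖b.basis.repr f (a 0)‖ ^ 2 :=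
      (Equiv.funUnique (Fin 1) (ι × Bool)).summable_iff.2 (summable_sq (b.basis.repr f))
    simpa [norm_smul, mul_pow, HilbertBasis.repr_apply_apply] using h.mul_right (‖x‖ ^ 2))⟩

/-- The superspace `H_Λ`, the closure of `Λ_0 ⊗ H_0 ⊕ Λ_1 ⊗ H_1` in `Λ ⊗ H`. -/
def ParticleBasis.superspace : Submodule ℂ (Tensor (ι × Bool) 1) :=
  (Submodule.span ℂ {X | ∃ k : ZMod 2, ∃ x ∈ Grassmann.parityPart k, ∃ f : H,
    S.HasParity k f ∧ X = b.tmul x f}).topologicalClosure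

theorem lmul_mem_superspace {x : Grassmann} (hx : x ∈ Grassmann.parityPart 0)
    {ζ : Tensor (ι × Bool) 1} (hζ : ζ ∈ b.superspace) : lmul x ζ ∈ b.superspace := by
  have hle : b.superspace ≤ b.superspace.comap (lmul x).toLinearMap := by
    refine Submodule.topologicalClosure_minimal _ (Submodule.span_le.2 ?_) ?_
    · rintro X ⟨k, y, hy, f, hf, rfl⟩
      refine Submodule.le_topologicalClosure _ (Submodule.subset_span
        ⟨k, x * y, Grassmann.mul_mem_parityPart hx hy, f, hf, ?_⟩)
      exact lp.ext (funext fun a => Grassmann.mul_smul' x y _)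
    · exact (Submodule.isClosed_topologicalClosure _).preimage (lmul x).continuous
  exact hle hζ

/-- The `Λ_0`-module structure of `H_Λ`. -/
def ParticleBasis.evenSMul (x : Grassmann.parityPart 0) (ζ : b.superspace) : b.superspace :=
  ⟨lmul x ζ, lmul_mem_superspace b x.2 ζ.2⟩

/-- The `Λ`-bilinear pairing of `Λ ⊗ H^{⊗ n}` with itself,
`⟨x ⊗ F | y ⊗ G⟩ = (x y) ⟨F | G⟩`, where `⟨F | G⟩ = (F* | G)` with the involution
`(f₁ ⊗ … ⊗ fₙ)* = fₙ* ⊗ … ⊗ f₁*`. On the basis, `(e a₁ ⊗ … ⊗ e aₙ)*` is the basis tensor with the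
indices `bar aₙ, …, bar a₁`. -/
def pairing {n : ℕ} (X Y : Tensor (ι × Bool) n) : Grassmann :=
  ∑' a : Fin n → ι × Bool, X a * Y (fun i => bar (a (Fin.rev i)))

/-- The sum which defines the pairing converges absolutely. -/
theorem summable_pairing {n : ℕ} (X Y : Tensor (ι × Bool) n) :
    Summable fun a : Fin n → ι × Bool => ‖X a * Y (fun i => bar (a (Fin.rev i)))‖ := by
  have hinv : Function.Involutive
      (fun (a : Fin n → ι × Bool) (i : Fin n) => bar (a (Fin.rev i))) := by
    intro a
    funext i
    simp [bar]
  have hY : Summable fun a : Fin n → ι × Bool => ‖Y (fun i => bar (a (Fin.rev i)))‖ ^ 2 :=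
    hinv.toPerm.summable_iff.2 (summable_sq Y)
  refine Summable.of_nonneg_of_le (fun _ => norm_nonneg _) (fun a => ?_)
    (((summable_sq X).add hY).mul_left (√3))
  refine (Grassmann.norm_mul_le' _ _).trans ?_
  rw [mul_assoc]
  refine mul_le_mul_of_nonneg_left ?_ (Real.sqrt_nonneg 3)
  nlinarith [sq_nonneg (‖X a‖ - ‖Y (fun i => bar (a (Fin.rev i)))‖), sq_nonneg (‖X a‖),
    sq_nonneg ‖Y (fun i => bar (a (Fin.rev i)))‖]

/-- The function `φ_Ξ(ζ) = ⟨exp ζ | Ξ⟩` on the superspace. -/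
def ParticleBasis.phi (Ξ : (p : ℕ) → Tensor (ι × Bool) p) (ζ : b.superspace) : Grassmann :=
  ∑' p, pairing (coherent b.parity (ζ : Tensor (ι × Bool) 1) p) (Ξ p)

/-- `f : H_Λ → Λ` is an entire analytic function of superanalysis: it is the sum of a power series
with infinite radius of convergence (in particular it is complex analytic, hence smooth, at
every point), and all of its Fréchet derivatives are `Λ_0`-linear in every argument. -/
structure ParticleBasis.IsEntire (f : b.superspace → Grassmann) : Prop where
  powerSeries : ∃ s : FormalMultilinearSeries ℂ b.superspace Grassmann,
    HasFPowerSeriesOnBall f s 0 ⊤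
  even_linear : ∀ (n : ℕ) (ζ : b.superspace) (v : Fin n → b.superspace) (i : Fin n)
    (x : Grassmann.parityPart 0),
    iteratedFDeriv ℂ n f ζ (Function.update v i (b.evenSMul x (v i))) =
      (x : Grassmann) * iteratedFDeriv ℂ n f ζ v

end Basis

end FockSuper

end

/-! The term of degree p of `φ_Ξ` is the restriction to the diagonal of a continuous multilinear
map: multiply p arguments with the graded product, pair with `Ξ p`, divide by p!. Everything rests
on its norm and on how it treats even scalars.

Norm. The graded projection is an average of isometries, hence a contraction. The square roots in
the products by one more factor telescope to √p!, and each product of Grassmann coefficients costs a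
factor c, except those with the unit tensor of degree 0. The pairing supplies one more c for p ≥ 1,
so the coefficient of degree p has norm at most c^p / √p! · ‖Ξ p‖. By Cauchy–Schwarz in p against
the weights (p!)^γ, the remaining series ∑ r^(2p) (p!)^(-1-γ) converges for every r exactly because
γ > -1 makes the factorial exponent negative; the radius is infinite. For γ = 0 the same
Cauchy–Schwarz step gives ∑ (c‖ζ‖)^(2p) / p! = exp(c²‖ζ‖²), whose square root is the asserted
exponential.

Even linearity. An even x is central and the Grassmann algebra is associative, so x can be pulled
out of any slot of any coefficient. This property survives a change of origin, being stable under
convergent sums, and then passes to all derivatives. Symmetry of the coefficients is not needed,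
since the derivative formula sums over permutations of the arguments. -/

noncomputable section

namespace FockSuper

/-! ### The Hilbert–Grassmann algebra: signs, centrality of even elements, associativity -/

namespace Grassmann

/-- Comparing coefficients of `κ A` instead of orthonormal coordinates keeps the factorials out of
the algebraic identities. -/
theorem coeff_ext {x y : Grassmann} (h : ∀ A, coeff x A = coeff y A) : x = y := by
  refine lp.ext (funext fun A => ?_)
  exact mul_left_cancel₀ (Nat.cast_ne_zero.2 (Nat.factorial_ne_zero _)) (h A)

theorem coeff_mul (x y : Grassmann) (C : Finset ℕ) : coeff (x * y) C = mulCoeff x y C := by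
  rw [coeff, mul_apply, mul_inv_cancel_left₀ (Nat.cast_ne_zero.2 (Nat.factorial_ne_zero _))]

theorem coeff_one (A : Finset ℕ) : coeff 1 A = if A = ∅ then 1 else 0 := by
  change (A.card ! : ℂ) * (lp.single 2 ∅ (1 : ℂ) : Grassmann) A = _
  rw [lp.single_apply]
  split_ifs with h
  · subst h
    simp
  · simp [h]

theorem norm_one' : ‖(1 : Grassmann)‖ = 1 := by
  change ‖(lp.single 2 ∅ (1 : ℂ) : Grassmann)‖ = 1
  rw [lp.norm_single (by norm_num)]
  exact CStarRing.norm_one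

theorem one_mul' (x : Grassmann) : 1 * x = x := by
  refine coeff_ext fun C => ?_
  rw [coeff_mul, mulCoeff, Finset.sum_eq_single ∅]
  · simp [coeff_one, sgn]
  · intro A _ hA
    simp [coeff_one, hA]
  · simp

theorem add_mul' (x y z : Grassmann) : (x + y) * z = x * z + y * z := by
  refine lp.ext (funext fun C => ?_)
  rw [lp.coeFn_add, Pi.add_apply, mul_apply, mul_apply, mul_apply, ← mul_add]
  simp only [mulCoeff, coeff, ← Finset.sum_add_distrib, lp.coeFn_add, Pi.add_apply]
  congr 1
  exact Finset.sum_congr rfl fun A _ => by ring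

theorem smul_mul' (c : ℂ) (x y : Grassmann) : (c • x) * y = c • (x * y) := by
  refine lp.ext (funext fun C => ?_)
  rw [lp.coeFn_smul, Pi.smul_apply, mul_apply, mul_apply]
  simp only [mulCoeff, coeff, lp.coeFn_smul, Pi.smul_apply, smul_eq_mul, Finset.mul_sum]
  exact Finset.sum_congr rfl fun A _ => by ring

/-- Inversions between two sets are counted pair by pair, so the count is additive in each set. This
bimultiplicativity is what makes the product associative. -/
theorem sgn_union_left {A B : Finset ℕ} (h : Disjoint A B) (C : Finset ℕ) :
    sgn (A ∪ B) C = sgn A C * sgn B C := by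
  rw [sgn, sgn, sgn, ← pow_add, Finset.union_product, Finset.filter_union,
    Finset.card_union_of_disjoint]
  refine Finset.disjoint_filter_filter (Finset.disjoint_product.2 (Or.inl h))

theorem sgn_union_right {B C : Finset ℕ} (h : Disjoint B C) (A : Finset ℕ) :
    sgn A (B ∪ C) = sgn A B * sgn A C := by
  rw [sgn, sgn, sgn, ← pow_add, Finset.product_union, Finset.filter_union,
    Finset.card_union_of_disjoint]
  refine Finset.disjoint_filter_filter (Finset.disjoint_product.2 (Or.inr h))

/-- Disjointness excludes ties, so each of the |A|·|B| pairs is an inversion for exactly one of the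
two orders. -/
theorem sgn_mul_sgn_swap {A B : Finset ℕ} (h : Disjoint A B) :
    sgn A B * sgn B A = (-1) ^ (A.card * B.card) := by
  have hswap : ((B ×ˢ A).filter fun q => q.2 < q.1).card =
      ((A ×ˢ B).filter fun q => ¬ q.2 < q.1).card := by
    refine Finset.card_bij (fun q _ => (q.2, q.1)) ?_ ?_ ?_
    · rintro ⟨b, a⟩ hq
      simp only [Finset.mem_filter, Finset.mem_product] at hq ⊢
      exact ⟨hq.1.symm, by omega⟩
    · rintro ⟨b, a⟩ _ ⟨b', a'⟩ _ heq
      simp only [Prod.mk.injEq] at heq ⊢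
      exact heq.symm
    · rintro ⟨a, b⟩ hq
      simp only [Finset.mem_filter, Finset.mem_product] at hq
      have hne : a ≠ b := fun h0 => Finset.disjoint_left.1 h hq.1.1 (h0 ▸ hq.1.2)
      refine ⟨(b, a), ?_, rfl⟩
      simp only [Finset.mem_filter, Finset.mem_product]
      exact ⟨hq.1.symm, by omega⟩
  rw [sgn, sgn, ← pow_add, hswap, Finset.card_filter_add_card_filter_not, Finset.card_product]

theorem sgn_comm {A B : Finset ℕ} (h : Disjoint A B) (hA : (A.card : ZMod 2) = 0) :
    sgn A B = sgn B A := by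
  have heven : Even A.card := (ZMod.natCast_eq_zero_iff_even).1 hA
  have h1 := sgn_mul_sgn_swap h
  rw [Even.neg_one_pow (heven.mul_right _)] at h1
  have h2 : sgn B A * sgn B A = 1 := by
    rw [sgn, ← pow_add, Even.neg_one_pow ⟨_, rfl⟩]
  calc sgn A B = sgn A B * (sgn B A * sgn B A) := by rw [h2, mul_one]
    _ = sgn B A := by rw [← mul_assoc, h1, one_mul]

/-- Even elements of the Hilbert-Grassmann algebra are central. -/
theorem mul_comm_of_even {x : Grassmann} (hx : x ∈ parityPart 0) (y : Grassmann) :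
    x * y = y * x := by
  refine coeff_ext fun C => ?_
  rw [coeff_mul, coeff_mul, mulCoeff, mulCoeff]
  refine Finset.sum_nbij' (fun A => C \ A) (fun A => C \ A) ?_ ?_ ?_ ?_ ?_
  · intro A _
    exact Finset.mem_powerset.2 Finset.sdiff_subset
  · intro A _
    exact Finset.mem_powerset.2 Finset.sdiff_subset
  · intro A hA
    exact Finset.sdiff_sdiff_eq_self (Finset.mem_powerset.1 hA)
  · intro A hA
    exact Finset.sdiff_sdiff_eq_self (Finset.mem_powerset.1 hA)
  · intro A hA
    rw [Finset.sdiff_sdiff_eq_self (Finset.mem_powerset.1 hA)]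
    by_cases h0 : x A = 0
    · simp [coeff, h0]
    -- Only sets A with `x A ≠ 0` contribute; these have even cardinality, so exchanging A with its
    -- complement in C costs no sign.
    · rw [sgn_comm Finset.disjoint_sdiff (hx A h0)]
      ring

/-- The Hilbert-Grassmann algebra is associative. -/
theorem mul_assoc' (x y z : Grassmann) : x * y * z = x * (y * z) := by
  refine coeff_ext fun C => ?_
  rw [coeff_mul, coeff_mul, mulCoeff, mulCoeff]
  simp only [coeff_mul, mulCoeff, Finset.mul_sum, Finset.sum_mul]
  rw [Finset.sum_sigma', Finset.sum_sigma']
  -- Both sides run over ordered partitions of C into three blocks. The left side indexes them by B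
  -- ⊆ A ⊆ C, the right side by B and D = A \ B; on both sides the sign is the product of the three
  -- signs between pairs of blocks.
  refine Finset.sum_bij' (fun q _ => ⟨q.2, q.1 \ q.2⟩) (fun q _ => ⟨q.1 ∪ q.2, q.1⟩) ?_ ?_ ?_ ?_ ?_
  · rintro ⟨A, B⟩ h
    simp only [Finset.mem_sigma, Finset.mem_powerset] at h ⊢
    exact ⟨h.2.trans h.1, Finset.sdiff_subset_sdiff h.1 le_rfl⟩
  · rintro ⟨B, D⟩ h
    simp only [Finset.mem_sigma, Finset.mem_powerset] at h ⊢
    exact ⟨Finset.union_subset h.1 (h.2.trans Finset.sdiff_subset), Finset.subset_union_left⟩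
  · rintro ⟨A, B⟩ h
    simp only [Finset.mem_sigma, Finset.mem_powerset] at h
    simp only [Finset.union_sdiff_of_subset h.2]
  · rintro ⟨B, D⟩ h
    simp only [Finset.mem_sigma, Finset.mem_powerset] at h
    have hd : Disjoint D B := (Finset.subset_sdiff.1 h.2).2
    simp only [Finset.union_sdiff_left, hd.sdiff_eq_left]
  · rintro ⟨A, B⟩ h
    simp only [Finset.mem_sigma, Finset.mem_powerset] at h
    obtain ⟨hA, hB⟩ := h
    have h1 : A = B ∪ A \ B := (Finset.union_sdiff_of_subset hB).symm
    have h2 : C \ B = A \ B ∪ C \ A := by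
      ext i
      simp only [Finset.mem_sdiff, Finset.mem_union]
      have := @hA i
      have := @hB i
      tauto
    have h3 : (C \ B) \ (A \ B) = C \ A := by
      ext i
      simp only [Finset.mem_sdiff]
      have := @hB i
      tauto
    have h4 : sgn A (C \ A) = sgn B (C \ A) * sgn (A \ B) (C \ A) := by
      conv_lhs => rw [h1]
      rw [sgn_union_left Finset.disjoint_sdiff, ← h1]
    have h5 : sgn B (C \ B) = sgn B (A \ B) * sgn B (C \ A) := by
      rw [h2, sgn_union_right]
      exact Finset.disjoint_sdiff.mono_left Finset.sdiff_subset
    simp only [h3]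
    rw [h4, h5]
    ring

end Grassmann

/-! ### Power series whose coefficients intertwine two maps, and their derivatives -/

section PowerSeries

variable {E F : Type*} [NormedAddCommGroup E] [NormedSpace ℂ E] [NormedAddCommGroup F]
  [NormedSpace ℂ F]

/-- Applying `t` to any one of the arguments of the multilinear map `f` amounts to applying `T` to
its value. -/
def Intertwines {n : ℕ} (t : E → E) (T : F →L[ℂ] F)
    (f : ContinuousMultilinearMap ℂ (fun _ : Fin n => E) F) : Prop :=
  ∀ (v : Fin n → E) (i : Fin n), f (Function.update v i (t (v i))) = T (f v)

/-- The term is `s (k + l)` with x in the slots of u and v in the others, so altering one entry of v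
alters one slot of `s (k + l)`. -/
theorem changeOriginSeriesTerm_intertwines {s : FormalMultilinearSeries ℂ E F} {t : E → E}
    {T : F →L[ℂ] F} (h : ∀ n, Intertwines t T (s n)) (k l : ℕ) (u : Finset (Fin (k + l)))
    (hu : u.card = l) (x : E) : Intertwines t T (s.changeOriginSeriesTerm k l u hu fun _ => x) := by
  intro v i
  rw [FormalMultilinearSeries.changeOriginSeriesTerm]
  simp only [ContinuousMultilinearMap.curryFinFinset_apply]
  have hc : (uᶜ).card = k := by
    rw [Finset.card_compl, Fintype.card_fin, hu, Nat.add_sub_cancel_right]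
  rw [← h (k + l) _ (finSumEquivOfFinset hu hc (Sum.inr i))]
  congr 1
  funext j
  obtain ⟨j, rfl⟩ := (finSumEquivOfFinset hu hc).surjective j
  rcases j with j | j
  · rw [Function.update_of_ne]
    · simp only [Equiv.symm_apply_apply, Sum.elim_inl]
    · exact fun h0 => nomatch (finSumEquivOfFinset hu hc).injective h0
  · by_cases hj : j = i
    · subst hj
      simp only [Equiv.symm_apply_apply, Sum.elim_inr, Function.update_self]
    · rw [Function.update_of_ne]
      · simp only [Equiv.symm_apply_apply, Sum.elim_inr, Function.update_of_ne hj]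
      · exact fun h0 => hj (Sum.inr_injective ((finSumEquivOfFinset hu hc).injective h0))

theorem changeOrigin_intertwines [CompleteSpace F] {s : FormalMultilinearSeries ℂ E F}
    (hr : s.radius = ⊤) {t : E → E} {T : F →L[ℂ] F} (h : ∀ n, Intertwines t T (s n)) (x : E) (k : ℕ) :
    Intertwines t T (s.changeOrigin x k) := by
  intro v i
  have hs : HasSum (fun l => s.changeOriginSeries k l fun _ => x) (s.changeOrigin x k) := by
    refine (s.changeOriginSeries k).hasSum ?_
    -- Infinite radius makes the re-expansion converge at every x, however far from the origin.
    rw [top_unique (hr.ge.trans (s.le_changeOriginSeries_radius k))]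
    exact Metric.mem_eball.2 (edist_lt_top _ _)
  have hev : ∀ w : Fin k → E, HasSum (fun l => s.changeOriginSeries k l (fun _ => x) w)
      (s.changeOrigin x k w) := fun w => ContinuousMultilinearMap.hasSum_eval hs w
  refine (hev _).unique ?_
  convert T.hasSum (hev v) using 2 with l
  simp only [FormalMultilinearSeries.changeOriginSeries, sum_apply, map_sum]
  exact Finset.sum_congr rfl fun u _ => changeOriginSeriesTerm_intertwines h k l u u.2 x v i

theorem iteratedFDeriv_intertwines [CompleteSpace F] {f : E → F} {s : FormalMultilinearSeries ℂ E F}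
    (hf : HasFPowerSeriesOnBall f s 0 ⊤) {t : E → E} {T : F →L[ℂ] F}
    (h : ∀ n, Intertwines t T (s n)) (n : ℕ) (x : E) :
    Intertwines t T (iteratedFDeriv ℂ n f x) := by
  intro v i
  have hx : HasFPowerSeriesOnBall f (s.changeOrigin x) x (⊤ - ‖x‖₊) := by
    have := hf.changeOrigin (y := x) (by simp)
    rwa [zero_add] at this
  rw [hx.iteratedFDeriv_eq_sum_of_completeSpace, hx.iteratedFDeriv_eq_sum_of_completeSpace,
    map_sum]
  refine Finset.sum_congr rfl fun σ _ => ?_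
  -- The derivative is the sum over σ of the coefficient at v ∘ σ; slot i of v sits in slot `σ.symm
  -- i` of v ∘ σ.
  rw [← changeOrigin_intertwines (top_unique hf.r_le) h x n _ (σ.symm i)]
  congr 1
  funext j
  by_cases hj : σ j = i
  · subst hj
    simp
  · rw [Function.update_of_ne hj, Function.update_of_ne]
    exact fun h0 => hj (by rw [h0, Equiv.apply_symm_apply])

end PowerSeries

theorem summable_mul_and_tsum_le_sqrt {α : Type*} {f g : α → ℝ} (hf0 : ∀ i, 0 ≤ f i)
    (hg0 : ∀ i, 0 ≤ g i) (hf : Summable fun i => f i ^ 2) (hg : Summable fun i => g i ^ 2) :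
    (Summable fun i => f i * g i) ∧
      ∑' i, f i * g i ≤ √(∑' i, f i ^ 2) * √(∑' i, g i ^ 2) := by
  have := Real.summable_and_inner_le_Lp_mul_Lq_tsum_of_nonneg Real.HolderConjugate.two_two hf0 hg0
    (by simpa using hf) (by simpa using hg)
  simpa [Real.sqrt_eq_rpow] using this

/-- Left multiplication by an element of the Hilbert-Grassmann algebra. -/
def Grassmann.mulLeft (x : Grassmann) : Grassmann →L[ℂ] Grassmann :=
  LinearMap.mkContinuous
    { toFun := fun y => x * y
      map_add' := Grassmann.mul_add' x
      map_smul' := fun c y => Grassmann.mul_smul' x y c }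
    (√3 * ‖x‖) (Grassmann.norm_mul_le' x)

theorem Grassmann.mulLeft_apply (x y : Grassmann) : Grassmann.mulLeft x y = x * y := rfl

/-- Tested on the unit, which has norm 1. This supplies the nonnegativity of c needed for
monotonicity of the estimates. -/
theorem Grassmann.one_le_of_norm_mul_le {c : ℝ}
    (hc : ∀ x y : Grassmann, ‖x * y‖ ≤ c * ‖x‖ * ‖y‖) : 1 ≤ c := by
  have := hc 1 1
  rwa [Grassmann.one_mul', Grassmann.norm_one', mul_one, mul_one] at this

/-! ### The graded product: norm estimates, multilinearity, even scalars -/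

section Tensor

variable {J : Type*}

/-- The constant K has to serve only the coefficients that occur: products with the unit tensor can
thus be estimated with K = 1 instead of c. This saving yields the sharp power of c later. -/
theorem norm_tensorMul_le {p q : ℕ} (X : Tensor J p) (Y : Tensor J q) {K : ℝ} (hK : 0 ≤ K)
    (h : ∀ a b, ‖X a * Y b‖ ≤ K * ‖X a‖ * ‖Y b‖) : ‖tensorMul X Y‖ ≤ K * ‖X‖ * ‖Y‖ := by
  refine norm_le_of_sq (by positivity) ?_
  have hXY := (summable_sq X).mul_of_nonneg (summable_sq Y) (fun _ => sq_nonneg _)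
    (fun _ => sq_nonneg _)
  have hle : ∀ r : (Fin p → J) × (Fin q → J),
      ‖X r.1 * Y r.2‖ ^ 2 ≤ K ^ 2 * (‖X r.1‖ ^ 2 * ‖Y r.2‖ ^ 2) := fun r => by
    rw [← mul_pow, ← mul_pow, ← mul_assoc]
    exact pow_le_pow_left₀ (norm_nonneg _) (h _ _) 2
  calc ∑' a, ‖tensorMul X Y a‖ ^ 2
      = ∑' r : (Fin p → J) × (Fin q → J), ‖X r.1 * Y r.2‖ ^ 2 :=
        (Fin.appendEquiv p q).symm.tsum_eq
          fun r : (Fin p → J) × (Fin q → J) => ‖X r.1 * Y r.2‖ ^ 2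
    _ ≤ ∑' r : (Fin p → J) × (Fin q → J), K ^ 2 * (‖X r.1‖ ^ 2 * ‖Y r.2‖ ^ 2) :=
        (Summable.of_nonneg_of_le (fun _ => sq_nonneg _) hle (hXY.mul_left _)).tsum_le_tsum hle
          (hXY.mul_left _)
    _ = (K * ‖X‖ * ‖Y‖) ^ 2 := by
        rw [tsum_mul_left, ← (summable_sq X).tsum_mul_tsum (summable_sq Y) hXY, ← norm_sq_eq,
          ← norm_sq_eq]
        ring

theorem norm_gradedPerm (par : J → ZMod 2) {n : ℕ} (σ : Equiv.Perm (Fin n)) (X : Tensor J n) :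
    ‖gradedPerm par σ X‖ = ‖X‖ := by
  have h : ‖gradedPerm par σ X‖ ^ 2 = ‖X‖ ^ 2 := by
    rw [norm_sq_eq, norm_sq_eq,
      ← (Equiv.arrowCongr σ (Equiv.refl J)).tsum_eq fun a => ‖X a‖ ^ 2]
    refine tsum_congr fun a => ?_
    change ‖(-1 : ℂ) ^ inversions par σ a • X (a ∘ σ.symm)‖ ^ 2 = ‖X (a ∘ σ.symm)‖ ^ 2
    simp [norm_smul]
  exact (sq_eq_sq₀ (norm_nonneg _) (norm_nonneg _)).1 h

theorem gradedPerm_add (par : J → ZMod 2) {n : ℕ} (σ : Equiv.Perm (Fin n)) (X Y : Tensor J n) :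
    gradedPerm par σ (X + Y) = gradedPerm par σ X + gradedPerm par σ Y :=
  lp.ext (funext fun _ => smul_add _ _ _)

theorem gradedPerm_smul (par : J → ZMod 2) {n : ℕ} (σ : Equiv.Perm (Fin n)) (c : ℂ)
    (X : Tensor J n) : gradedPerm par σ (c • X) = c • gradedPerm par σ X :=
  lp.ext (funext fun a => smul_comm ((-1 : ℂ) ^ inversions par σ a) c (X (a ∘ σ.symm)))

theorem gradedPerm_lmul (par : J → ZMod 2) {n : ℕ} (σ : Equiv.Perm (Fin n)) (x : Grassmann)
    (X : Tensor J n) : gradedPerm par σ (lmul x X) = lmul x (gradedPerm par σ X) :=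
  lp.ext (funext fun _ => (Grassmann.mul_smul' _ _ _).symm)

theorem gradedProj_add (par : J → ZMod 2) {n : ℕ} (X Y : Tensor J n) :
    gradedProj par (X + Y) = gradedProj par X + gradedProj par Y := by
  simp only [gradedProj, gradedPerm_add, Finset.sum_add_distrib, smul_add]

theorem gradedProj_smul (par : J → ZMod 2) {n : ℕ} (c : ℂ) (X : Tensor J n) :
    gradedProj par (c • X) = c • gradedProj par X := by
  simp only [gradedProj, gradedPerm_smul, ← Finset.smul_sum]
  exact smul_comm _ _ _

theorem gradedProj_lmul (par : J → ZMod 2) {n : ℕ} (x : Grassmann) (X : Tensor J n) :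
    gradedProj par (lmul x X) = lmul x (gradedProj par X) := by
  simp only [gradedProj, gradedPerm_lmul, map_smul, map_sum]

/-- An average of n! isometries is a contraction. -/
theorem norm_gradedProj_le (par : J → ZMod 2) {n : ℕ} (X : Tensor J n) :
    ‖gradedProj par X‖ ≤ ‖X‖ := by
  have hn : (0 : ℝ) < n ! := by exact_mod_cast n.factorial_pos
  rw [gradedProj, norm_smul, norm_inv, Complex.norm_natCast, inv_mul_le_iff₀ hn]
  refine (norm_sum_le _ _).trans (le_of_eq ?_)
  simp [norm_gradedPerm, Fintype.card_perm]

theorem tensorMul_add_left {p q : ℕ} (X X' : Tensor J p) (Y : Tensor J q) :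
    tensorMul (X + X') Y = tensorMul X Y + tensorMul X' Y :=
  lp.ext (funext fun _ => Grassmann.add_mul' _ _ _)

theorem tensorMul_smul_left {p q : ℕ} (c : ℂ) (X : Tensor J p) (Y : Tensor J q) :
    tensorMul (c • X) Y = c • tensorMul X Y :=
  lp.ext (funext fun _ => Grassmann.smul_mul' _ _ _)

theorem tensorMul_add_right {p q : ℕ} (X : Tensor J p) (Y Y' : Tensor J q) :
    tensorMul X (Y + Y') = tensorMul X Y + tensorMul X Y' :=
  lp.ext (funext fun _ => Grassmann.mul_add' _ _ _)

theorem tensorMul_smul_right {p q : ℕ} (c : ℂ) (X : Tensor J p) (Y : Tensor J q) :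
    tensorMul X (c • Y) = c • tensorMul X Y :=
  lp.ext (funext fun _ => Grassmann.mul_smul' _ _ _)

theorem tensorMul_lmul_left {p q : ℕ} (x : Grassmann) (X : Tensor J p) (Y : Tensor J q) :
    tensorMul (lmul x X) Y = lmul x (tensorMul X Y) :=
  lp.ext (funext fun _ => Grassmann.mul_assoc' _ _ _)

/-- Here x has to move past the coefficients of X, so it must be central; pulling it out of the left
factor takes associativity only. -/
theorem tensorMul_lmul_right {p q : ℕ} {x : Grassmann} (hx : x ∈ Grassmann.parityPart 0)
    (X : Tensor J p) (Y : Tensor J q) : tensorMul X (lmul x Y) = lmul x (tensorMul X Y) := by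
  refine lp.ext (funext fun a => ?_)
  change X _ * (x * Y _) = x * (X _ * Y _)
  rw [← Grassmann.mul_assoc', ← Grassmann.mul_assoc', Grassmann.mul_comm_of_even hx]

theorem norm_gradedMul_le (par : J → ZMod 2) {p q : ℕ} (X : Tensor J p) (Y : Tensor J q) {K : ℝ}
    (hK : 0 ≤ K) (h : ∀ a b, ‖X a * Y b‖ ≤ K * ‖X a‖ * ‖Y b‖) :
    ‖gradedMul par X Y‖ ≤ √(((p + q)! : ℝ) / ((p ! : ℝ) * (q ! : ℝ))) * K * ‖X‖ * ‖Y‖ := by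
  rw [gradedMul, norm_smul, Complex.norm_real, Real.norm_of_nonneg (Real.sqrt_nonneg _),
    mul_assoc, mul_assoc]
  refine mul_le_mul_of_nonneg_left ?_ (Real.sqrt_nonneg _)
  rw [← mul_assoc]
  exact (norm_gradedProj_le _ _).trans (norm_tensorMul_le X Y hK h)

theorem gradedMul_lmul_left (par : J → ZMod 2) {p q : ℕ} (x : Grassmann) (X : Tensor J p)
    (Y : Tensor J q) : gradedMul par (lmul x X) Y = lmul x (gradedMul par X Y) := by
  simp only [gradedMul, tensorMul_lmul_left, gradedProj_lmul, map_smul]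

theorem gradedMul_lmul_right (par : J → ZMod 2) {p q : ℕ} {x : Grassmann}
    (hx : x ∈ Grassmann.parityPart 0) (X : Tensor J p) (Y : Tensor J q) :
    gradedMul par X (lmul x Y) = lmul x (gradedMul par X Y) := by
  simp only [gradedMul, tensorMul_lmul_right hx, gradedProj_lmul, map_smul]

/-- The graded product as a continuous bilinear map. -/
def gradedMulL (par : J → ZMod 2) (p q : ℕ) :
    Tensor J p →L[ℂ] Tensor J q →L[ℂ] Tensor J (p + q) :=
  LinearMap.mkContinuous₂
    (LinearMap.mk₂ ℂ (fun (X : Tensor J p) (Y : Tensor J q) => gradedMul par X Y)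
      (fun X X' Y => by simp only [gradedMul, tensorMul_add_left, gradedProj_add, smul_add])
      (fun c X Y => by
        simp only [gradedMul, tensorMul_smul_left, gradedProj_smul]; exact smul_comm _ _ _)
      (fun X Y Y' => by simp only [gradedMul, tensorMul_add_right, gradedProj_add, smul_add])
      (fun c X Y => by
        simp only [gradedMul, tensorMul_smul_right, gradedProj_smul]; exact smul_comm _ _ _))
    (√(((p + q)! : ℝ) / ((p ! : ℝ) * (q ! : ℝ))) * √3)
    (fun X Y => norm_gradedMul_le par X Y (Real.sqrt_nonneg 3)
      fun _ _ => Grassmann.norm_mul_le' _ _)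

/-- The graded product of `p` tensors of degree one as a continuous multilinear map. -/
def gradedMulti (par : J → ZMod 2) :
    (p : ℕ) → ContinuousMultilinearMap ℂ (fun _ : Fin p => Tensor J 1) (Tensor J p)
  | 0 => ContinuousMultilinearMap.uncurry0 ℂ (Tensor J 1) (lp.single 2 Fin.elim0 1)
  | p + 1 => ((gradedMulL par p 1).compContinuousMultilinearMap
      (gradedMulti par p)).uncurryRight

theorem gradedMulti_zero (par : J → ZMod 2) (v : Fin 0 → Tensor J 1) :
    gradedMulti par 0 v = lp.single 2 Fin.elim0 1 := rfl

theorem gradedMulti_succ (par : J → ZMod 2) (p : ℕ) (v : Fin (p + 1) → Tensor J 1) :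
    gradedMulti par (p + 1) v =
      gradedMul par (gradedMulti par p (Fin.init v)) (v (Fin.last p)) := rfl

theorem gradedMulti_const (par : J → ZMod 2) (ζ : Tensor J 1) (p : ℕ) :
    gradedMulti par p (fun _ => ζ) = gradedPow par ζ p := by
  induction p with
  | zero => rfl
  | succ p ih =>
    rw [gradedMulti_succ, gradedPow, ← ih]
    rfl

theorem gradedMulti_update_lmul (par : J → ZMod 2) {x : Grassmann}
    (hx : x ∈ Grassmann.parityPart 0) (p : ℕ) :
    ∀ (v : Fin p → Tensor J 1) (i : Fin p),
      gradedMulti par p (Function.update v i (lmul x (v i))) = lmul x (gradedMulti par p v) := by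
  induction p with
  | zero => exact fun v i => i.elim0
  | succ p ih =>
    intro v i
    rw [gradedMulti_succ, gradedMulti_succ]
    induction i using Fin.lastCases with
    | last => rw [Fin.init_update_last, Function.update_self, gradedMul_lmul_right par hx]
    | cast i =>
      rw [Fin.init_update_castSucc, Function.update_of_ne (Fin.castSucc_lt_last i).ne',
        ← gradedMul_lmul_left]
      congr 1
      exact ih (Fin.init v) i

theorem norm_gradedMulti_zero (par : J → ZMod 2) (v : Fin 0 → Tensor J 1) :
    ‖gradedMulti par 0 v‖ = 1 := by
  rw [gradedMulti_zero, lp.norm_single (by norm_num), Grassmann.norm_one']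

theorem gradedMulti_zero_apply (par : J → ZMod 2) (v : Fin 0 → Tensor J 1) (a : Fin 0 → J) :
    gradedMulti par 0 v a = 1 := by
  rw [Subsingleton.elim a Fin.elim0, gradedMulti_zero, lp.single_apply_self]

theorem norm_gradedMulti_zero_mul (par : J → ZMod 2) (v : Fin 0 → Tensor J 1) (a : Fin 0 → J)
    (y : Grassmann) :
    ‖gradedMulti par 0 v a * y‖ ≤ 1 * ‖gradedMulti par 0 v a‖ * ‖y‖ := by
  rw [gradedMulti_zero_apply, Grassmann.one_mul', Grassmann.norm_one', one_mul, one_mul]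

/-- The normalising constants of successive products by one more factor telescope to √p!. -/
theorem sqrt_factorial_succ (p : ℕ) :
    √(((p + 1)! : ℝ) / ((p ! : ℝ) * (1 ! : ℝ))) * √(p ! : ℝ) = √((p + 1)! : ℝ) := by
  have hp : (0 : ℝ) < p ! := by exact_mod_cast p.factorial_pos
  rw [← Real.sqrt_mul (by positivity), Nat.factorial_one, Nat.cast_one, mul_one,
    div_mul_cancel₀ _ hp.ne']

/-- Of the p successive products the first has the unit as its left factor and costs no c, hence the
exponent p - 1. For p = 0 truncated subtraction gives c⁰, as it should. -/
theorem norm_gradedMulti_le {c : ℝ} (hc : ∀ x y : Grassmann, ‖x * y‖ ≤ c * ‖x‖ * ‖y‖)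
    (par : J → ZMod 2) (p : ℕ) : ∀ v : Fin p → Tensor J 1,
      ‖gradedMulti par p v‖ ≤ √(p ! : ℝ) * c ^ (p - 1) * ∏ i, ‖v i‖ := by
  have hc0 : 0 ≤ c := zero_le_one.trans (Grassmann.one_le_of_norm_mul_le hc)
  induction p with
  | zero =>
    intro v
    rw [norm_gradedMulti_zero]
    simp
  | succ p ih =>
    intro v
    rw [gradedMulti_succ, Fin.prod_univ_castSucc, ← sqrt_factorial_succ, Nat.add_sub_cancel]
    rcases p with _ | p
    · refine (norm_gradedMul_le par _ _ zero_le_one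
        fun a b => norm_gradedMulti_zero_mul par _ a _).trans (le_of_eq ?_)
      rw [norm_gradedMulti_zero]
      simp
    · refine (norm_gradedMul_le par _ _ hc0 fun a b => hc _ _).trans ?_
      have h := ih (Fin.init v)
      rw [Nat.add_sub_cancel] at h
      calc _ ≤ √(((p + 1 + 1)! : ℝ) / (((p + 1)! : ℝ) * (1 ! : ℝ))) * c *
            (√((p + 1)! : ℝ) * c ^ p * ∏ i, ‖Fin.init v i‖) * ‖v (Fin.last (p + 1))‖ := by gcongr
        _ = _ := by
          rw [pow_succ]
          simp only [Fin.init]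
          ring

end Tensor

/-! ### The pairing: Cauchy–Schwarz bound and linearity over the Grassmann algebra -/

section Pairing

variable {ι : Type*}

/-- The involution `(a 0, …, a (n - 1)) ↦ (bar (a (n - 1)), …, bar (a 0))` of multi-indices. -/
def barRev (ι : Type*) (n : ℕ) : Equiv.Perm (Fin n → ι × Bool) :=
  Function.Involutive.toPerm (fun a i => bar (a (Fin.rev i))) fun a => by
    funext i
    simp [bar]

/-- Cauchy–Schwarz on the multi-indices; conjugating and reversing them is a permutation, which
leaves the norm of Y unchanged. -/
theorem norm_pairing_le {n : ℕ} (X Y : Tensor (ι × Bool) n) {K : ℝ} (hK : 0 ≤ K)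
    (h : ∀ a b, ‖X a * Y b‖ ≤ K * ‖X a‖ * ‖Y b‖) : ‖pairing X Y‖ ≤ K * ‖X‖ * ‖Y‖ := by
  have hY : Summable fun a => ‖Y (barRev ι n a)‖ ^ 2 :=
    (barRev ι n).summable_iff.2 (summable_sq Y)
  obtain ⟨hs, hle⟩ := summable_mul_and_tsum_le_sqrt (fun a => norm_nonneg (X a))
    (fun a => norm_nonneg (Y (barRev ι n a))) (summable_sq X) hY
  rw [(barRev ι n).tsum_eq fun a => ‖Y a‖ ^ 2, ← norm_sq_eq, ← norm_sq_eq,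
    Real.sqrt_sq (norm_nonneg _), Real.sqrt_sq (norm_nonneg _)] at hle
  calc ‖pairing X Y‖ ≤ ∑' a, ‖X a * Y (barRev ι n a)‖ :=
        norm_tsum_le_tsum_norm (summable_pairing X Y)
    _ ≤ ∑' a, K * (‖X a‖ * ‖Y (barRev ι n a)‖) :=
        (summable_pairing X Y).tsum_le_tsum (fun a => (h _ _).trans_eq (mul_assoc _ _ _))
          (hs.mul_left K)
    _ ≤ K * ‖X‖ * ‖Y‖ := by
        rw [tsum_mul_left, mul_assoc]
        exact mul_le_mul_of_nonneg_left hle hK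

theorem pairing_add_left {n : ℕ} (X X' Y : Tensor (ι × Bool) n) :
    pairing (X + X') Y = pairing X Y + pairing X' Y := by
  rw [pairing, pairing, pairing,
    ← (summable_pairing X Y).of_norm.tsum_add (summable_pairing X' Y).of_norm]
  exact tsum_congr fun a => Grassmann.add_mul' _ _ _

theorem pairing_smul_left {n : ℕ} (c : ℂ) (X Y : Tensor (ι × Bool) n) :
    pairing (c • X) Y = c • pairing X Y := by
  rw [pairing, pairing, ← (summable_pairing X Y).of_norm.tsum_const_smul]
  exact tsum_congr fun a => Grassmann.smul_mul' _ _ _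

theorem pairing_lmul_left {n : ℕ} (x : Grassmann) (X Y : Tensor (ι × Bool) n) :
    pairing (lmul x X) Y = x * pairing X Y := by
  rw [← Grassmann.mulLeft_apply, pairing, pairing,
    (Grassmann.mulLeft x).map_tsum (summable_pairing X Y).of_norm]
  exact tsum_congr fun a => Grassmann.mul_assoc' _ _ _

/-- The pairing with a fixed tensor as a continuous linear map. -/
def pairingL {n : ℕ} (Y : Tensor (ι × Bool) n) : Tensor (ι × Bool) n →L[ℂ] Grassmann :=
  LinearMap.mkContinuous
    { toFun := fun X => pairing X Y
      map_add' := fun X X' => pairing_add_left X X' Y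
      map_smul' := fun c X => pairing_smul_left c X Y }
    (√3 * ‖Y‖) (fun X => (norm_pairing_le X Y (Real.sqrt_nonneg 3)
      fun _ _ => Grassmann.norm_mul_le' _ _).trans_eq (mul_right_comm _ _ _))

/-- The pairing adds one factor c to c^(p-1). In degree 0 the left argument is the unit, so nothing
is added and the exponent is p there too. -/
theorem norm_pairing_gradedMulti_le {c : ℝ}
    (hc : ∀ x y : Grassmann, ‖x * y‖ ≤ c * ‖x‖ * ‖y‖) (par : ι × Bool → ZMod 2) (p : ℕ)
    (v : Fin p → Tensor (ι × Bool) 1) (Y : Tensor (ι × Bool) p) :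
    ‖pairing (gradedMulti par p v) Y‖ ≤ √(p ! : ℝ) * c ^ p * ‖Y‖ * ∏ i, ‖v i‖ := by
  have hc0 : 0 ≤ c := zero_le_one.trans (Grassmann.one_le_of_norm_mul_le hc)
  rcases p with _ | p
  · refine (norm_pairing_le _ _ zero_le_one
      fun a b => norm_gradedMulti_zero_mul par v a _).trans (le_of_eq ?_)
    rw [norm_gradedMulti_zero]
    simp
  · refine (norm_pairing_le _ _ hc0 fun a b => hc _ _).trans ?_
    have h := norm_gradedMulti_le hc par (p + 1) v
    rw [Nat.add_sub_cancel] at h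
    calc _ ≤ c * (√((p + 1)! : ℝ) * c ^ p * ∏ i, ‖v i‖) * ‖Y‖ := by gcongr
      _ = _ := by
        rw [pow_succ]
        ring

end Pairing

/-- Ratio test: successive terms have ratio |r| (p + 1)^δ, which tends to 0 as δ < 0. -/
theorem summable_pow_mul_factorial_rpow {δ : ℝ} (hδ : δ < 0) (r : ℝ) :
    Summable fun p : ℕ => r ^ p * (p ! : ℝ) ^ δ := by
  have hpos : ∀ p : ℕ, (0 : ℝ) < p ! := fun p => by exact_mod_cast p.factorial_pos
  rcases eq_or_ne r 0 with rfl | hr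
  -- The ratio test needs nonzero terms; for r = 0 only the term p = 0 survives.
  · exact summable_of_ne_finset_zero (s := {0}) fun p hp => by
      rw [zero_pow (by simpa using hp), zero_mul]
  refine summable_of_ratio_test_tendsto_lt_one (l := 0) one_pos
    (.of_forall fun p => mul_ne_zero (pow_ne_zero _ hr) (Real.rpow_pos_of_pos (hpos p) δ).ne') ?_
  have heq : ∀ p : ℕ, ‖r ^ (p + 1) * ((p + 1)! : ℝ) ^ δ‖ / ‖r ^ p * (p ! : ℝ) ^ δ‖ =
      ‖r‖ * ((p + 1 : ℕ) : ℝ) ^ δ := by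
    intro p
    have h1 : 0 < (p ! : ℝ) ^ δ := Real.rpow_pos_of_pos (hpos p) δ
    have h2 : ‖r‖ ^ p ≠ 0 := pow_ne_zero _ (norm_ne_zero_iff.2 hr)
    rw [Nat.factorial_succ, Nat.cast_mul, Real.mul_rpow (Nat.cast_nonneg _) (hpos p).le, norm_mul,
      norm_mul, norm_mul, norm_pow, norm_pow, Real.norm_of_nonneg h1.le,
      Real.norm_of_nonneg (Real.rpow_nonneg (Nat.cast_nonneg _) δ), pow_succ]
    field_simp
  simp only [heq]
  have h3 : Filter.Tendsto (fun p : ℕ => ((p + 1 : ℕ) : ℝ) ^ δ) Filter.atTop (nhds 0) := by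
    have := (tendsto_rpow_neg_atTop (neg_pos.2 hδ)).comp
      (tendsto_natCast_atTop_atTop.comp (Filter.tendsto_add_atTop_nat 1))
    simpa [Function.comp_def] using this
  simpa using h3.const_mul ‖r‖

/-! ### The power series of `φ_Ξ`, its radius, and the exponential bound -/

section Entire

variable {H : Type*} [NormedAddCommGroup H] [InnerProductSpace ℂ H] {S : OneParticle H}
  {ι : Type*} (b : ParticleBasis S ι)

/-- The power series of the function `φ_Ξ`. -/
def ParticleBasis.phiSeries (Ξ : (p : ℕ) → Tensor (ι × Bool) p) :
    FormalMultilinearSeries ℂ b.superspace Grassmann := fun p =>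
  (p ! : ℂ)⁻¹ • (pairingL (Ξ p)).compContinuousMultilinearMap
    ((gradedMulti b.parity p).compContinuousLinearMap fun _ => b.superspace.subtypeL)

theorem ParticleBasis.phiSeries_apply (Ξ : (p : ℕ) → Tensor (ι × Bool) p) (p : ℕ)
    (v : Fin p → b.superspace) : b.phiSeries Ξ p v =
      (p ! : ℂ)⁻¹ • pairing (gradedMulti b.parity p fun i => (v i : Tensor (ι × Bool) 1)) (Ξ p) :=
  rfl

theorem ParticleBasis.phiSeries_apply_const (Ξ : (p : ℕ) → Tensor (ι × Bool) p) (p : ℕ)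
    (ζ : b.superspace) : b.phiSeries Ξ p (fun _ => ζ) =
      pairing (coherent b.parity (ζ : Tensor (ι × Bool) 1) p) (Ξ p) := by
  rw [ParticleBasis.phiSeries_apply, gradedMulti_const, coherent, pairing_smul_left]

theorem ParticleBasis.phiSeries_intertwines (Ξ : (p : ℕ) → Tensor (ι × Bool) p)
    (x : Grassmann.parityPart 0) (p : ℕ) :
    Intertwines (b.evenSMul x) (Grassmann.mulLeft x) (b.phiSeries Ξ p) := by
  intro v i
  rw [ParticleBasis.phiSeries_apply, ParticleBasis.phiSeries_apply, map_smul,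
    Grassmann.mulLeft_apply, ← pairing_lmul_left, ← gradedMulti_update_lmul b.parity x.2 p _ i]
  congr 3
  funext j
  by_cases hj : j = i
  · subst hj
    simp only [Function.update_self]
    rfl
  · simp only [Function.update_of_ne hj]

theorem ParticleBasis.norm_phiSeries_le {c : ℝ}
    (hc : ∀ x y : Grassmann, ‖x * y‖ ≤ c * ‖x‖ * ‖y‖) (Ξ : (p : ℕ) → Tensor (ι × Bool) p)
    (p : ℕ) : ‖b.phiSeries Ξ p‖ ≤ c ^ p / √(p ! : ℝ) * ‖Ξ p‖ := by
  have hc0 : 0 ≤ c := zero_le_one.trans (Grassmann.one_le_of_norm_mul_le hc)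
  have hp : (0 : ℝ) < p ! := by exact_mod_cast p.factorial_pos
  refine ContinuousMultilinearMap.opNorm_le_bound (by positivity) fun v => ?_
  rw [ParticleBasis.phiSeries_apply, norm_smul, norm_inv, Complex.norm_natCast,
    inv_mul_le_iff₀ hp]
  refine (norm_pairing_gradedMulti_le hc b.parity p _ _).trans (le_of_eq ?_)
  have h : (p ! : ℝ) * (c ^ p / √(p ! : ℝ)) = √(p ! : ℝ) * c ^ p := by
    rw [mul_div_left_comm, Real.div_sqrt, mul_comm]
  rw [← h, mul_assoc, mul_assoc, mul_assoc]
  rfl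

theorem ParticleBasis.summable_norm_phiSeries {γ : ℝ} (hγ : -1 < γ)
    {Ξ : (p : ℕ) → Tensor (ι × Bool) p} (hΞ : IsFock b.parity γ Ξ) {r : ℝ} (hr : 0 ≤ r) :
    Summable fun p => ‖b.phiSeries Ξ p‖ * r ^ p := by
  have hpos : ∀ p : ℕ, (0 : ℝ) < p ! := fun p => by exact_mod_cast p.factorial_pos
  -- The factor 1/√p! is split as (p!)^((-1-γ)/2) · (p!)^(γ/2). The square of the first part, with
  -- its powers, is summable since -1 - γ < 0; that of the second, times ‖Ξ p‖, by the Fock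
  -- condition. Any admissible c would do for convergence, and √3 is one.
  obtain ⟨hs, -⟩ := summable_mul_and_tsum_le_sqrt
    (f := fun p : ℕ => (√3 * r) ^ p * (p ! : ℝ) ^ ((-1 - γ) / 2))
    (g := fun p : ℕ => (p ! : ℝ) ^ (γ / 2) * ‖Ξ p‖)
    (fun p => by positivity) (fun p => by positivity)
    (by
      refine (summable_pow_mul_factorial_rpow (δ := -1 - γ) (by linarith)
        ((√3 * r) ^ 2)).congr fun p => ?_
      rw [mul_pow ((√3 * r) ^ p), ← pow_mul, ← pow_mul, mul_comm 2 p, ← Real.rpow_mul_natCast (hpos p).le]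
      congr 2
      push_cast
      ring)
    (by
      refine hΞ.2.congr fun p => ?_
      rw [mul_pow, ← Real.rpow_mul_natCast (hpos p).le]
      congr 2
      push_cast
      ring)
  refine Summable.of_nonneg_of_le (fun p => by positivity) (fun p => ?_) hs
  refine (mul_le_mul_of_nonneg_right (b.norm_phiSeries_le Grassmann.norm_mul_le' Ξ p)
    (by positivity)).trans (le_of_eq ?_)
  have h : (p ! : ℝ) ^ ((-1 - γ) / 2) * (p ! : ℝ) ^ (γ / 2) = (√(p ! : ℝ))⁻¹ := by
    rw [← Real.rpow_add (hpos p), Real.sqrt_eq_rpow, ← Real.rpow_neg (hpos p).le]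
    congr 1
    ring
  rw [div_eq_mul_inv, ← h, mul_pow]
  ring

theorem ParticleBasis.norm_phiSeries_apply_const_le (Ξ : (p : ℕ) → Tensor (ι × Bool) p)
    (ζ : b.superspace) (p : ℕ) :
    ‖b.phiSeries Ξ p fun _ => ζ‖ ≤ ‖b.phiSeries Ξ p‖ * ‖ζ‖ ^ p := by
  simpa using (b.phiSeries Ξ p).le_opNorm fun _ => ζ

theorem ParticleBasis.hasFPowerSeriesOnBall_phi {γ : ℝ} (hγ : -1 < γ)
    {Ξ : (p : ℕ) → Tensor (ι × Bool) p} (hΞ : IsFock b.parity γ Ξ) :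
    HasFPowerSeriesOnBall (b.phi Ξ) (b.phiSeries Ξ) 0 ⊤ where
  r_le := ((b.phiSeries Ξ).radius_eq_top_of_summable_norm fun r =>
    b.summable_norm_phiSeries hγ hΞ r.2).ge
  r_pos := ENNReal.zero_lt_top
  hasSum := by
    intro ζ _
    have hs : Summable fun p => b.phiSeries Ξ p fun _ => ζ :=
      Summable.of_norm_bounded (b.summable_norm_phiSeries hγ hΞ (norm_nonneg ζ))
        (b.norm_phiSeries_apply_const_le Ξ ζ)
    rw [zero_add, ParticleBasis.phi]
    simpa only [ParticleBasis.phiSeries_apply_const] using hs.hasSum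

/-- The function of a tensor `Ξ ∈ S^Λ_(γ)(H)` with `γ > -1` is entire. -/
theorem ParticleBasis.isEntire_phi {γ : ℝ} (hγ : -1 < γ) {Ξ : (p : ℕ) → Tensor (ι × Bool) p}
    (hΞ : IsFock b.parity γ Ξ) : b.IsEntire (b.phi Ξ) where
  powerSeries := ⟨_, b.hasFPowerSeriesOnBall_phi hγ hΞ⟩
  even_linear n ζ v i x := iteratedFDeriv_intertwines (b.hasFPowerSeriesOnBall_phi hγ hΞ)
    (b.phiSeries_intertwines Ξ x) n ζ v i

theorem ParticleBasis.norm_phi_le {Ξ : (p : ℕ) → Tensor (ι × Bool) p}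
    (hΞ : IsFock b.parity 0 Ξ) {c : ℝ} (hc : ∀ x y : Grassmann, ‖x * y‖ ≤ c * ‖x‖ * ‖y‖)
    (ζ : b.superspace) : ‖b.phi Ξ ζ‖ ≤ fockNorm 0 Ξ * Real.exp (c ^ 2 * ‖ζ‖ ^ 2 / 2) := by
  have hc0 : 0 ≤ c := zero_le_one.trans (Grassmann.one_le_of_norm_mul_le hc)
  -- The squared weights form the exponential series; the square root in Cauchy–Schwarz then
  -- produces the ½ in the exponent.
  have hexp : HasSum (fun p : ℕ => ((c * ‖ζ‖) ^ p / √(p ! : ℝ)) ^ 2)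
      (Real.exp (c ^ 2 * ‖ζ‖ ^ 2)) := by
    rw [Real.exp_eq_exp_ℝ]
    have h := NormedSpace.expSeries_div_hasSum_exp (c ^ 2 * ‖ζ‖ ^ 2)
    refine (funext fun p => ?_ : (fun p : ℕ => ((c * ‖ζ‖) ^ p / √(p ! : ℝ)) ^ 2) =
      fun p : ℕ => (c ^ 2 * ‖ζ‖ ^ 2) ^ p / (p ! : ℝ)) ▸ h
    rw [div_pow, Real.sq_sqrt (Nat.cast_nonneg _), ← mul_pow, ← pow_mul, ← pow_mul,
      mul_comm 2 p]
  have hΞ2 : Summable fun p => ‖Ξ p‖ ^ 2 := by simpa using hΞ.2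
  obtain ⟨hs, hle⟩ := summable_mul_and_tsum_le_sqrt
    (fun p : ℕ => by positivity) (fun p : ℕ => norm_nonneg (Ξ p)) hexp.summable hΞ2
  have hterm : ∀ p, ‖pairing (coherent b.parity (ζ : Tensor (ι × Bool) 1) p) (Ξ p)‖ ≤
      (c * ‖ζ‖) ^ p / √(p ! : ℝ) * ‖Ξ p‖ := fun p => by
    rw [← ParticleBasis.phiSeries_apply_const]
    refine (b.norm_phiSeries_apply_const_le Ξ ζ p).trans ?_
    refine (mul_le_mul_of_nonneg_right (b.norm_phiSeries_le hc Ξ p)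
      (by positivity)).trans (le_of_eq ?_)
    rw [mul_pow]
    ring
  calc ‖b.phi Ξ ζ‖ ≤ ∑' p : ℕ, (c * ‖ζ‖) ^ p / √(p ! : ℝ) * ‖Ξ p‖ :=
        tsum_of_norm_bounded hs.hasSum hterm
    _ ≤ √(Real.exp (c ^ 2 * ‖ζ‖ ^ 2)) * √(∑' p, ‖Ξ p‖ ^ 2) := by rwa [hexp.tsum_eq] at hle
    _ = fockNorm 0 Ξ * Real.exp (c ^ 2 * ‖ζ‖ ^ 2 / 2) := by
        rw [Real.exp_half, fockNorm, mul_comm]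
        simp only [Real.rpow_zero, one_mul]

end Entire

end FockSuper

end

theorem mainTheorem9 {H : Type*} [NormedAddCommGroup H] [InnerProductSpace ℂ H] [CompleteSpace H]
    (S : FockSuper.OneParticle H) {ι : Type*} (b : FockSuper.ParticleBasis S ι) :
    (∀ γ : ℝ, -1 < γ → ∀ Ξ : (p : ℕ) → FockSuper.Tensor (ι × Bool) p,
      FockSuper.IsFock b.parity γ Ξ →
        (∀ ζ : b.superspace, Summable fun p =>
          ‖FockSuper.pairing (FockSuper.coherent b.parity ζ p) (Ξ p)‖) ∧
        b.IsEntire (b.phi Ξ)) ∧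
    (∀ Ξ : (p : ℕ) → FockSuper.Tensor (ι × Bool) p, FockSuper.IsFock b.parity 0 Ξ →
      (∀ ζ : b.superspace,
        ‖b.phi Ξ ζ‖ ≤ FockSuper.fockNorm 0 Ξ * Real.exp (√3 ^ 2 * ‖ζ‖ ^ 2 / 2)) ∧
      ∀ c : ℝ, (∀ x y : FockSuper.Grassmann, ‖x * y‖ ≤ c * ‖x‖ * ‖y‖) →
        ∀ ζ : b.superspace,
          ‖b.phi Ξ ζ‖ ≤ FockSuper.fockNorm 0 Ξ * Real.exp (c ^ 2 * ‖ζ‖ ^ 2 / 2)) := by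
  refine ⟨fun γ hγ Ξ hΞ => ⟨fun ζ => ?_, b.isEntire_phi hγ hΞ⟩, fun Ξ hΞ =>
    ⟨b.norm_phi_le hΞ FockSuper.Grassmann.norm_mul_le', fun c hc => b.norm_phi_le hΞ hc⟩⟩
  -- Absolute convergence comes from the majorant ∑ ‖s_p‖ ‖ζ‖^p of the power series, with s_p its
  -- coefficient of degree p.
  refine Summable.of_nonneg_of_le (fun p => norm_nonneg _) (fun p => ?_)
    (b.summable_norm_phiSeries hγ hΞ (norm_nonneg ζ))
  rw [← FockSuper.ParticleBasis.phiSeries_apply_const]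
  exact b.norm_phiSeries_apply_const_le Ξ ζ p
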